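/- **Theorem (Bezout).** Let $k$ be an algebraically closed field, $n\ge 0$, and $g_1,\dots,g_n\in k[x_1,\dots,x_n]$, $\mathcal G=\{g_1,\dots,g_n\}$. For a multi-index $\alpha\in\mathbb Z_{\ge 0}^n$ let $D^\alpha=\partial_1^{\alpha_1}\cdots\partial_n^{\alpha_n}$ denote the iterated formal partial derivative on $k[x_1,\dots,x_n]$, and for a polynomial $p=\sum_\beta p_\beta x^\beta$ let $p(D)=\sum_\beta p_\beta D^\beta$ be the corresponding differential operator with constant coefficients. For $x\in k^n$ put $$D_x(\mathcal G)=\{\,p\in k[x_1,\dots,x_n] : \big([D^\alpha p](D)\,g_i\big)(x)=0 \text{ for } i=1,\dots,n \text{ and all } \alpha\in\mathbb Z_{\ge 0}^n\,\},$$ $$I_x(\mathcal G)=\dim_k D_x(\mathcal G)\in\{0,1,2,\dots\}\cup\{\infty\}.$$ Suppose that $g_1,\dots,g_n$ have no intersection at infinity, that is, the leading forms of $g_1,\dots,g_n$ (the leading form of $g_i$ is its homogeneous component of degree $\deg g_i$) have no common zero in $k^n$ other than $0$. Then $$\sum_{x\in k^n} I_x(\mathcal G)=\deg(g_1)\cdots\deg(g_n)\qquad\text{or}\qquad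 \sum_{x\in k^n} I_x(\mathcal G)=\infty .$$ Here $\deg$ is the total degree (with $\deg 0=0$). -/

import Mathlib

namespace Bezout

variable {k : Type*} [Field k] {n : ℕ}

/-- The partial differential operator `D^α = ∂₁^{α₁} ⋯ ∂ₙ^{αₙ}` acting on `k[x₁,…,xₙ]`
(formal partial derivatives, iterated; the product is composition of operators). -/
noncomputable def partialD (α : Fin n →₀ ℕ) : Module.End k (MvPolynomial (Fin n) k) :=
  (List.ofFn fun i : Fin n =>
    ((MvPolynomial.pderiv i : Derivation k (MvPolynomial (Fin n) k) (MvPolynomial (Fin n) k)) :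
      Module.End k (MvPolynomial (Fin n) k)) ^ α i).prod

/-- The constant coefficient operator `p(D) = ∑_β p_β D^β` attached to `p = ∑_β p_β x^β`;
it depends linearly on `p`. -/
noncomputable def polyD :
    MvPolynomial (Fin n) k →ₗ[k] Module.End k (MvPolynomial (Fin n) k) :=
  (MvPolynomial.basisMonomials (Fin n) k).constr k partialD

theorem polyD_apply (p : MvPolynomial (Fin n) k) :
    polyD p = ∑ β ∈ p.support, p.coeff β • partialD β := by
  rw [polyD, Module.Basis.constr_apply]
  rfl

/-- The space `D_x(G)` of all polynomials `p` such that `[D^α p](D) g_i (x) = 0` for every `i`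
and every multi-index `α`. -/
noncomputable def dualSpace {ι : Type*} (g : ι → MvPolynomial (Fin n) k) (x : Fin n → k) :
    Submodule k (MvPolynomial (Fin n) k) where
  carrier := {p | ∀ (i : ι) (α : Fin n →₀ ℕ),
    MvPolynomial.eval x (polyD (partialD α p) (g i)) = 0}
  add_mem' {p q} hp hq i α := by
    simp only [map_add, LinearMap.add_apply, hp i α, hq i α, add_zero]
  zero_mem' i α := by
    simp only [map_zero, LinearMap.zero_apply]
  smul_mem' c p hp i α := by
    simp only [map_smul, LinearMap.smul_apply, MvPolynomial.smul_eval, hp i α, mul_zero]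

/-- The multiplicity `I_x(G) = dim D_x(G)`, with value `∞` if the space is not finite
dimensional. -/
noncomputable def multiplicity {ι : Type*} (g : ι → MvPolynomial (Fin n) k) (x : Fin n → k) :
    ℕ∞ :=
  Cardinal.toENat (Module.rank k (dualSpace g x))

/-- The sum over all points of `kⁿ` of the multiplicities never takes a junk value. -/
theorem summable_multiplicity {ι : Type*} (g : ι → MvPolynomial (Fin n) k) :
    Summable fun x : Fin n → k => multiplicity g x :=
  ⟨_, hasSum_of_isLUB _ (isLUB_iSup (f := fun s : Finset (Fin n → k) => ∑ x ∈ s, multiplicity g x))⟩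

/-- The leading form of `f`: the sum of its terms of degree `deg f`. -/
noncomputable def leadingForm (f : MvPolynomial (Fin n) k) : MvPolynomial (Fin n) k :=
  MvPolynomial.homogeneousComponent f.totalDegree f

/-- The hypersurfaces `g_i = 0` have no common point at infinity. A point at infinity is
`(0 : v₁ : ⋯ : vₙ)` with `v ≠ 0`, and the homogenization of `g_i` takes there the value at `v`
of the leading form of `g_i`. -/
def NoIntersectionAtInfinity {ι : Type*} (g : ι → MvPolynomial (Fin n) k) : Prop :=
  ∀ v : Fin n → k, (∀ i, MvPolynomial.eval v (leadingForm (g i)) = 0) → v = 0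

end Bezout

/-! Let I = (g_1, …, g_n) and A = k[X]/I. The proof compares both the sum and the product with dim
A.

Dimension of A. The leading forms vanish together only at 0, so by the Nullstellensatz they form a
system of parameters of the regular local ring at the origin, hence a regular sequence there;
homogeneity carries this back to k[X] (`isWeaklyRegular_of_forms`). Regularity prevents cancellation
among top terms, so the top forms of elements of I lie in the ideal of the leading forms, and the
Hilbert series of degrees ≤ m is ∏ (1 - t^{d_i}) / (1 - t)^{n+1}. Its coefficients are eventually ∏
d_i, which is therefore dim A.

Sum of multiplicities. The functional f ↦ (p(D) f)(x) pairs (X - x)^α with α! p_α. If all α! are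
nonzero in k, the polynomials p correspond to the functionals killed by powers of the X_i - x_i, and
D_x(G) to the joint generalized eigenspace at x of the transposed multiplications on the dual of A
(`map_evalD_dualSpace`). These operators commute and k is algebraically closed, so the eigenspaces
decompose the dual and the multiplicities sum to dim A. If some α! is zero in k, the characteristic
is positive and n > 0; then every multiplicity is infinite. -/

namespace Bezout

open MvPolynomial

/-! ### Differential operators as functionals at a point -/

section Operators

variable {k : Type*} [Field k] {n : ℕ}

/-- Induction on multi-indices, one unit at a time. -/
theorem multiIndex_induction {motive : (Fin n →₀ ℕ) → Prop} (zero : motive 0)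
    (add_single : ∀ α j, motive α → motive (α + Finsupp.single j 1)) (α : Fin n →₀ ℕ) :
    motive α := by
  induction α using Finsupp.induction with
  | zero => exact zero
  | single_add i a f _ _ ih =>
    clear * - ih add_single
    induction a with
    | zero => simpa using ih
    | succ a iha =>
      have := add_single _ i iha
      rwa [add_right_comm, ← Finsupp.single_add] at this

theorem pderiv_pderiv_comm (i j : Fin n) (p : MvPolynomial (Fin n) k) :
    pderiv i (pderiv j p) = pderiv j (pderiv i p) := by
  ext m
  simp only [coeff_pderiv, Finsupp.add_apply]
  rw [add_right_comm]
  by_cases h : i = j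
  · subst h; rfl
  · rw [Finsupp.single_eq_of_ne h, Finsupp.single_eq_of_ne (Ne.symm h)]
    simp only [add_zero]; ring

theorem prod_ofFn_pow_add_single {M : Type*} [Monoid M] : ∀ {n : ℕ} (f : Fin n → M)
    (_ : ∀ i j, Commute (f i) (f j)) (e : Fin n → ℕ) (j : Fin n),
    (List.ofFn fun i => f i ^ (e i + if j = i then 1 else 0)).prod =
      f j * (List.ofFn fun i => f i ^ e i).prod
  | 0, _, _, _, j => j.elim0
  | n + 1, f, hf, e, j => by
    rw [List.ofFn_succ, List.ofFn_succ, List.prod_cons, List.prod_cons]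
    refine Fin.cases ?_ (fun j => ?_) j
    · simp [(Fin.succ_ne_zero _).symm, pow_succ', mul_assoc]
    · have := prod_ofFn_pow_add_single (fun i => f i.succ) (fun i j => hf _ _)
        (fun i => e i.succ) j
      simp only [Fin.succ_inj]
      rw [this]
      simp only [Fin.succ_ne_zero, if_false, add_zero, ← mul_assoc]
      rw [((hf j.succ 0).pow_right _).eq]

theorem partialD_zero : partialD (k := k) (0 : Fin n →₀ ℕ) = 1 := by
  simp [partialD]

theorem partialD_add_single (α : Fin n →₀ ℕ) (j : Fin n) (p : MvPolynomial (Fin n) k) :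
    partialD (α + Finsupp.single j 1) p = pderiv j (partialD α p) := by
  have := prod_ofFn_pow_add_single
    (fun i : Fin n => ((pderiv i : Derivation k (MvPolynomial (Fin n) k) (MvPolynomial (Fin n) k)) :
      Module.End k (MvPolynomial (Fin n) k)))
    (fun i j => LinearMap.ext fun p => pderiv_pderiv_comm i j p) α j
  simp only [partialD, Finsupp.add_apply, Finsupp.single_apply]
  rw [this]
  rfl

theorem polyD_monomial (α : Fin n →₀ ℕ) (c : k) : polyD (monomial α c) = c • partialD α := by
  rw [← mul_one c, ← smul_eq_mul, ← smul_monomial, map_smul, smul_eq_mul, mul_one]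
  congr 1
  exact (basisMonomials (Fin n) k).constr_basis k partialD α

theorem polyD_C (c : k) (f : MvPolynomial (Fin n) k) : polyD (C c) f = C c * f := by
  rw [← monomial_zero', polyD_monomial, partialD_zero]
  simp [smul_eq_C_mul]

theorem polyD_mul_X (p : MvPolynomial (Fin n) k) (j : Fin n) (f : MvPolynomial (Fin n) k) :
    polyD (p * X j) f = pderiv j (polyD p f) := by
  induction p using MvPolynomial.induction_on' with
  | monomial α c =>
    rw [X, monomial_mul, mul_one, polyD_monomial, polyD_monomial, LinearMap.smul_apply,
      LinearMap.smul_apply, partialD_add_single, Derivation.map_smul]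
  | add p q hp hq => rw [add_mul, map_add, map_add, LinearMap.add_apply, LinearMap.add_apply,
      map_add, hp, hq]

/-- The commutator of `p(D)` with multiplication by `X i` is `(∂ᵢ p)(D)`. -/
theorem polyD_X_mul_apply (p : MvPolynomial (Fin n) k) (i : Fin n) (f : MvPolynomial (Fin n) k) :
    polyD p (X i * f) = X i * polyD p f + polyD (pderiv i p) f := by
  induction p using MvPolynomial.induction_on with
  | C a => simp only [polyD_C, pderiv_C, map_zero, LinearMap.zero_apply]; ring
  | add p q hp hq => simp only [map_add, LinearMap.add_apply, hp, hq]; ring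
  | mul_X p j hp =>
    rw [polyD_mul_X, hp, pderiv_mul, map_add, map_add, polyD_mul_X, LinearMap.add_apply,
      polyD_mul_X, pderiv_mul]
    by_cases h : i = j
    · subst h; simp only [pderiv_X_self]; rw [one_mul, mul_one]; ring
    · rw [pderiv_X_of_ne h, pderiv_X_of_ne (Ne.symm h)]; simp only [zero_mul, mul_zero, map_zero, LinearMap.zero_apply]; ring

theorem polyD_one_apply (p : MvPolynomial (Fin n) k) : polyD p 1 = C (coeff 0 p) := by
  induction p using MvPolynomial.induction_on with
  | C a => simp [polyD_C]
  | add p q hp hq => simp only [map_add, LinearMap.add_apply, hp, hq, coeff_add]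
  | mul_X p j hp => rw [polyD_mul_X, hp]; simp [coeff_mul_X']

/-- The functional `f ↦ (p(D) f)(x)`, depending linearly on `p`. -/
noncomputable def evalD (x : Fin n → k) :
    MvPolynomial (Fin n) k →ₗ[k] Module.Dual k (MvPolynomial (Fin n) k) :=
  (LinearMap.compRight k (aeval x).toLinearMap).comp polyD

theorem evalD_apply (x : Fin n → k) (p f : MvPolynomial (Fin n) k) :
    evalD x p f = eval x (polyD p f) := by
  simp [evalD, aeval_eq_eval]

/-- The monomial `(X - x)^α`. -/
noncomputable def shift (x : Fin n → k) (α : Fin n →₀ ℕ) : MvPolynomial (Fin n) k :=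
  ∏ i, (X i - C (x i)) ^ α i

theorem shift_zero (x : Fin n → k) : shift x 0 = 1 := by simp [shift]

theorem shift_add (x : Fin n → k) (α β : Fin n →₀ ℕ) :
    shift x (α + β) = shift x α * shift x β := by
  simp [shift, pow_add, Finset.prod_mul_distrib]

theorem shift_single (x : Fin n → k) (j : Fin n) (m : ℕ) :
    shift x (Finsupp.single j m) = (X j - C (x j)) ^ m := by
  classical
  rw [shift, Finset.prod_eq_single j]
  · simp
  · intro b _ hb; simp [Finsupp.single_eq_of_ne hb]
  · simp

theorem span_shift (x : Fin n → k) : Submodule.span k (Set.range (shift x)) = ⊤ := by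
  refine Submodule.eq_top_iff'.2 fun f => ?_
  induction f using MvPolynomial.induction_on with
  | C a =>
    have := Submodule.smul_mem _ a (Submodule.subset_span (R := k) (Set.mem_range_self (f := shift x) 0))
    simpa [shift_zero, smul_eq_C_mul] using this
  | add p q hp hq => exact add_mem hp hq
  | mul_X p j hp =>
    induction hp using Submodule.span_induction with
    | mem _ h =>
      obtain ⟨α, rfl⟩ := h
      have h1 := Submodule.subset_span (R := k)
        (Set.mem_range_self (f := shift x) (α + Finsupp.single j 1))
      have h2 := Submodule.smul_mem _ (x j) (Submodule.subset_span (R := k)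
        (Set.mem_range_self (f := shift x) α))
      convert add_mem h1 h2 using 1
      rw [shift_add, shift_single, smul_eq_C_mul]; ring
    | zero => simp
    | add p q _ _ hp hq => rw [add_mul]; exact add_mem hp hq
    | smul a p _ hp => rw [smul_mul_assoc]; exact Submodule.smul_mem _ _ hp

/-- In the commutator formula the term with the factor X_i - x_i dies at x. Differentiating p is
thus transposed to multiplication by X_i - x_i. -/
theorem evalD_pderiv (x : Fin n → k) (i : Fin n) (p f : MvPolynomial (Fin n) k) :
    evalD x (pderiv i p) f = evalD x p ((X i - C (x i)) * f) := by
  have : polyD p (C (x i) * f) = C (x i) * polyD p f := by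
    rw [← smul_eq_C_mul, map_smul, smul_eq_C_mul]
  rw [evalD_apply, evalD_apply, sub_mul, map_sub, polyD_X_mul_apply, this]
  simp

theorem evalD_partialD (x : Fin n → k) (α : Fin n →₀ ℕ) (p f : MvPolynomial (Fin n) k) :
    evalD x (partialD α p) f = evalD x p (shift x α * f) := by
  induction α using multiIndex_induction generalizing f with
  | zero => simp [partialD_zero, shift_zero]
  | add_single α j ih =>
    rw [partialD_add_single, evalD_pderiv, ih, shift_add, shift_single, pow_one, mul_assoc]

open Nat in
-- Keeping the factorials on both sides avoids division, so the identity holds in every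
-- characteristic.
theorem factorial_mul_coeff_partialD (α : Fin n →₀ ℕ) (p : MvPolynomial (Fin n) k)
    (m : Fin n →₀ ℕ) :
    ((∏ i, (m i)! : ℕ) : k) * coeff m (partialD α p) =
      ((∏ i, ((m + α) i)! : ℕ) : k) * coeff (m + α) p := by
  induction α using multiIndex_induction generalizing m with
  | zero => simp [partialD_zero]
  | add_single α j ih =>
    rw [partialD_add_single, coeff_pderiv, ← add_assoc, add_right_comm, ← ih]
    have : (∏ i, ((m + Finsupp.single j 1 : Fin n →₀ ℕ) i)! : ℕ) = (∏ i, (m i)!) * (m j + 1) := by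
      rw [Fintype.prod_eq_mul_prod_compl j, Fintype.prod_eq_mul_prod_compl j (fun i => (m i)!)]
      rw [Finset.prod_congr rfl (g := fun i => (m i)!)]
      · simp [Nat.factorial_succ]; ring
      · intro i hi
        have : i ≠ j := by simpa using hi
        simp [Finsupp.single_eq_of_ne this]
    rw [this]; push_cast; ring

open Nat in
theorem evalD_shift (x : Fin n → k) (p : MvPolynomial (Fin n) k) (α : Fin n →₀ ℕ) :
    evalD x p (shift x α) = ((∏ i, (α i)! : ℕ) : k) * coeff α p := by
  have := factorial_mul_coeff_partialD α p 0
  rw [zero_add] at this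
  rw [← this, ← mul_one (shift x α), ← evalD_partialD, evalD_apply, polyD_one_apply]
  simp

/-- The derivatives of p correspond to multiplication by the (X - x)^α, and these span k[X]; hence
vanishing on the generators under all D^α is vanishing on the ideal. -/
theorem mem_dualSpace_iff {ι : Type*} (g : ι → MvPolynomial (Fin n) k) (x : Fin n → k)
    (p : MvPolynomial (Fin n) k) :
    p ∈ dualSpace g x ↔ ∀ f ∈ Ideal.span (Set.range g), evalD x p f = 0 := by
  constructor
  · intro hp f hf
    have key : ∀ i (q : MvPolynomial (Fin n) k), evalD x p (q * g i) = 0 := by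
      intro i q
      have hq : q ∈ Submodule.span k (Set.range (shift x)) := span_shift x ▸ trivial
      induction hq using Submodule.span_induction with
      | mem _ h =>
        obtain ⟨α, rfl⟩ := h
        rw [← evalD_partialD, evalD_apply]
        exact hp i α
      | zero => simp
      | add a b _ _ ha hb => rw [add_mul, map_add, ha, hb, add_zero]
      | smul c a _ ha => rw [smul_mul_assoc, map_smul, ha, smul_zero]
    induction hf using Submodule.span_induction with
    | mem _ h => obtain ⟨i, rfl⟩ := h; simpa using key i 1
    | zero => simp
    | add a b _ _ ha hb => rw [map_add, ha, hb, add_zero]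
    -- Vanishing at f alone says nothing about a • f, so a second induction runs with a arbitrary.
    | smul a f hf _ =>
      clear * - hf key
      induction hf using Submodule.span_induction generalizing a with
      | mem _ h => obtain ⟨i, rfl⟩ := h; exact key i a
      | zero => simp
      | add u v _ _ hu hv => rw [smul_add, map_add, hu, hv, add_zero]
      | smul b f _ hf => rw [smul_smul]; exact hf _
  · intro h i α
    rw [← evalD_apply, evalD_partialD]
    exact h _ (Ideal.mul_mem_left _ _ (Ideal.subset_span ⟨i, rfl⟩))

end Operators

/-! ### Multiplicities and the dual of the quotient algebra -/

section Multiplicity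

variable {k : Type*} [Field k] {n : ℕ}

/-- The transpose of multiplication by `X i` on the dual space of `k[X] ⧸ I`. -/
noncomputable def transposeX (I : Ideal (MvPolynomial (Fin n) k)) (i : Fin n) :
    Module.End k (Module.Dual k (MvPolynomial (Fin n) k ⧸ I)) :=
  (LinearMap.mulLeft k (Ideal.Quotient.mk I (X i))).dualMap

theorem transposeX_comm (I : Ideal (MvPolynomial (Fin n) k)) (i j : Fin n) :
    Commute (transposeX I i) (transposeX I j) := by
  refine LinearMap.ext fun φ => LinearMap.ext fun a => ?_
  change φ (_ * (_ * a)) = φ (_ * (_ * a))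
  rw [mul_left_comm]

theorem transposeX_sub_pow_apply (I : Ideal (MvPolynomial (Fin n) k)) (i : Fin n) (c : k) (N : ℕ)
    (φ : Module.Dual k (MvPolynomial (Fin n) k ⧸ I)) (f : MvPolynomial (Fin n) k) :
    ((transposeX I i - algebraMap k _ c) ^ N) φ (Ideal.Quotient.mk I f) =
      φ (Ideal.Quotient.mk I ((X i - C c) ^ N * f)) := by
  induction N generalizing f with
  | zero => simp
  | succ N ih =>
    rw [pow_succ', Module.End.mul_apply, pow_succ, mul_assoc, ← ih]
    rw [sub_mul, map_sub, map_sub, ← smul_eq_C_mul]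
    rw [LinearMap.sub_apply, LinearMap.sub_apply, Module.algebraMap_end_apply,
      LinearMap.smul_apply]
    congr 1
    exact (map_smul _ c _).symm

/-- The functionals on `k[X] ⧸ I` which are supported at the point `x`. -/
noncomputable def localDual (I : Ideal (MvPolynomial (Fin n) k)) (x : Fin n → k) :
    Submodule k (Module.Dual k (MvPolynomial (Fin n) k ⧸ I)) :=
  ⨅ i, (transposeX I i).maxGenEigenspace (x i)

theorem mem_localDual_iff (I : Ideal (MvPolynomial (Fin n) k)) (x : Fin n → k)
    (φ : Module.Dual k (MvPolynomial (Fin n) k ⧸ I)) :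
    φ ∈ localDual I x ↔
      ∀ i, ∃ N : ℕ, ∀ f, φ (Ideal.Quotient.mk I ((X i - C (x i)) ^ N * f)) = 0 := by
  rw [localDual, Module.End.mem_iInf_maxGenEigenspace_iff]
  refine forall_congr' fun i => exists_congr fun N => ⟨fun h f => ?_, fun h => ?_⟩
  · rw [← transposeX_sub_pow_apply]
    exact LinearMap.congr_fun h _
  · refine LinearMap.ext fun a => ?_
    obtain ⟨f, rfl⟩ := Ideal.Quotient.mk_surjective a
    exact (transposeX_sub_pow_apply I i (x i) N φ f).trans (h f)

theorem iSupIndep_localDual (I : Ideal (MvPolynomial (Fin n) k)) : iSupIndep (localDual I) :=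
  Module.End.independent_iInf_maxGenEigenspace_of_forall_mapsTo _ fun i j _ =>
    Module.End.mapsTo_maxGenEigenspace_of_comm (transposeX_comm I j i) _

theorem iSup_localDual [IsAlgClosed k] (I : Ideal (MvPolynomial (Fin n) k))
    [FiniteDimensional k (MvPolynomial (Fin n) k ⧸ I)] : ⨆ x, localDual I x = ⊤ :=
  Module.End.iSup_iInf_maxGenEigenspace_eq_top_of_iSup_maxGenEigenspace_eq_top_of_commute _
    (fun i j _ => transposeX_comm I i j) fun _ => Module.End.iSup_maxGenEigenspace_eq_top _

theorem tsum_finrank_of_iSupIndep {ι K V : Type*} [Field K] [AddCommGroup V] [Module K V]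
    [FiniteDimensional K V] {W : ι → Submodule K V} (h : iSupIndep W) (h' : ⨆ i, W i = ⊤) :
    ∑' i, (Module.finrank K (W i) : ℕ∞) = Module.finrank K V := by
  classical
  have hfin : {i | W i ≠ ⊥}.Finite := WellFoundedGT.finite_ne_bot_of_iSupIndep h
  have hint := DirectSum.isInternal_ne_bot_iff.2
    (DirectSum.isInternal_submodule_of_iSupIndep_of_iSup_eq_top h h')
  have : Fintype {i // W i ≠ ⊥} := hfin.fintype
  let b := hint.collectedBasis fun i => Module.finBasis K (W i)
  have h1 : Module.finrank K V = ∑ i : {i // W i ≠ ⊥}, Module.finrank K (W i) := by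
    rw [Module.finrank_eq_card_basis b]
    simp
  rw [tsum_eq_sum (s := hfin.toFinset), h1, ← Finset.sum_subtype hfin.toFinset
    (by simp) (fun i => Module.finrank K (W i)), Nat.cast_sum]
  intro i hi
  have : W i = ⊥ := by simpa using hi
  simp [this]

open Nat in
-- A functional given by p is killed by (X_i - x_i)^N for N > deg p, because such derivatives of p
-- vanish. Conversely, a functional killed by powers of all X_i - x_i is nonzero on only finitely
-- many (X - x)^α, and p is read off from these values.
theorem map_evalD_dualSpace (hfac : ∀ α : Fin n →₀ ℕ, ((∏ i, (α i)! : ℕ) : k) ≠ 0)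
    {ι : Type*} (g : ι → MvPolynomial (Fin n) k) (x : Fin n → k) :
    (dualSpace g x).map (evalD x) = (localDual (Ideal.span (Set.range g)) x).map
      (Ideal.Quotient.mkₐ k (Ideal.span (Set.range g))).toLinearMap.dualMap := by
  set I := Ideal.span (Set.range g)
  apply le_antisymm
  · rintro _ ⟨p, hp, rfl⟩
    have hp' := (mem_dualSpace_iff g x p).1 hp
    refine ⟨(I.restrictScalars k).liftQ (evalD x p) (fun f hf => hp' f hf), ?_, ?_⟩
    · refine (mem_localDual_iff _ _ _).2 fun i => ⟨p.totalDegree + 1, fun f => ?_⟩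
      change evalD x p _ = 0
      rw [← shift_single, ← evalD_partialD]
      have : partialD (Finsupp.single i (p.totalDegree + 1)) p = 0 := by
        ext m
        have h1 := factorial_mul_coeff_partialD (Finsupp.single i (p.totalDegree + 1)) p m
        rw [coeff_eq_zero_of_totalDegree_lt (d := m + _), mul_zero] at h1
        · simpa [hfac m] using (mul_eq_zero.1 h1).resolve_left (hfac m)
        · change _ < Finsupp.degree _
          rw [map_add, Finsupp.degree_single]
          omega
      rw [this, map_zero, LinearMap.zero_apply]
    · ext; rfl
  · rintro _ ⟨ψ, hψ, rfl⟩
    choose N hN using (mem_localDual_iff _ _ _).1 hψ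
    have hzero : ∀ α : Fin n →₀ ℕ, ¬ α ≤ Finsupp.equivFunOnFinite.symm N →
        ψ (Ideal.Quotient.mk I (shift x α)) = 0 := by
      intro α hα
      obtain ⟨i, hi⟩ : ∃ i, N i ≤ α i := by
        by_contra! h
        exact hα fun i => (h i).le
      have : α = Finsupp.single i (N i) + (α - Finsupp.single i (N i)) := by
        rw [add_tsub_cancel_of_le]
        exact Finsupp.single_le_iff.2 hi
      rw [this, shift_add, shift_single, hN]
    -- The coefficients are forced by `evalD_shift`, which multiplies them by α!.
    let p : MvPolynomial (Fin n) k :=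
      ∑ α ∈ Finset.Iic (Finsupp.equivFunOnFinite.symm N),
        monomial α ((((∏ i, (α i)! : ℕ) : k))⁻¹ * ψ (Ideal.Quotient.mk I (shift x α)))
    have hp : evalD x p = (Ideal.Quotient.mkₐ k I).toLinearMap.dualMap ψ := by
      refine LinearMap.ext_on_range (span_shift x) fun α => ?_
      rw [evalD_shift]
      change _ = ψ (Ideal.Quotient.mk I (shift x α))
      simp only [p, coeff_sum, coeff_monomial, Finset.sum_ite_eq', Finset.mem_Iic]
      split_ifs with h
      · rw [mul_inv_cancel_left₀ (hfac α)]
      · rw [mul_zero, hzero α h]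
    refine ⟨p, (mem_dualSpace_iff g x p).2 fun f hf => ?_, hp⟩
    rw [hp]
    change ψ (Ideal.Quotient.mk I f) = 0
    rw [Ideal.Quotient.eq_zero_iff_mem.2 hf, map_zero]

open Nat in
theorem evalD_injective (hfac : ∀ α : Fin n →₀ ℕ, ((∏ i, (α i)! : ℕ) : k) ≠ 0) (x : Fin n → k) :
    Function.Injective (evalD x) := by
  refine (injective_iff_map_eq_zero _).2 fun p hp => ?_
  ext α
  have := evalD_shift x p α
  rw [hp, LinearMap.zero_apply] at this
  simpa using (mul_eq_zero.1 this.symm).resolve_left (hfac α)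

open Nat in
theorem tsum_multiplicity [IsAlgClosed k]
    (hfac : ∀ α : Fin n →₀ ℕ, ((∏ i, (α i)! : ℕ) : k) ≠ 0)
    {ι : Type*} (g : ι → MvPolynomial (Fin n) k)
    [FiniteDimensional k (MvPolynomial (Fin n) k ⧸ Ideal.span (Set.range g))] :
    ∑' x, multiplicity g x =
      Module.finrank k (MvPolynomial (Fin n) k ⧸ Ideal.span (Set.range g)) := by
  rw [← Subspace.dual_finrank_eq, ← tsum_finrank_of_iSupIndep
    (iSupIndep_localDual (Ideal.span (Set.range g))) (iSup_localDual _)]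
  refine tsum_congr fun x => ?_
  have e : dualSpace g x ≃ₗ[k] localDual (Ideal.span (Set.range g)) x :=
    (Submodule.equivMapOfInjective _ (evalD_injective hfac x) _).trans
      ((LinearEquiv.ofEq _ _ (map_evalD_dualSpace hfac g x)).trans
        (Submodule.equivMapOfInjective _ (LinearMap.dualMap_injective_of_surjective
          Ideal.Quotient.mk_surjective) _).symm)
  rw [multiplicity, e.rank_eq, ← Module.finrank_eq_rank, Cardinal.toENat_nat]

theorem partialD_eq_zero_of_pderiv_eq_zero {p : MvPolynomial (Fin n) k}
    (hp : ∀ i, pderiv i p = 0) {α : Fin n →₀ ℕ} (hα : α ≠ 0) : partialD α p = 0 := by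
  have : partialD α p = 0 ∨ α = 0 ∧ partialD α p = p := by
    clear hα
    induction α using multiIndex_induction with
    | zero => right; simp [partialD_zero]
    | add_single α j ih =>
      left
      rw [partialD_add_single]
      obtain h | ⟨-, h⟩ := ih
      · rw [h, map_zero]
      · rw [h, hp]
  exact this.resolve_right fun h => hα h.1

/-- If all ∂_i p vanish, p(D) commutes with every X_i, so it is determined by its value p_0 at 1. -/
theorem polyD_eq_zero_of_pderiv_eq_zero {p : MvPolynomial (Fin n) k}
    (hp : ∀ i, pderiv i p = 0) (hp0 : coeff 0 p = 0) : polyD p = 0 := by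
  refine LinearMap.ext fun f => ?_
  induction f using MvPolynomial.induction_on with
  | C a =>
    rw [← mul_one (C a), ← smul_eq_C_mul, map_smul, polyD_one_apply, hp0]; simp
  | add f g hf hg => rw [map_add, hf, hg, map_add]
  | mul_X f i hf => rw [mul_comm, polyD_X_mul_apply, hf, hp]; simp

/-- In characteristic `p > 0` every point has infinite multiplicity. -/
theorem multiplicity_eq_top (p : ℕ) [CharP k p] (hp : p ≠ 0) (i : Fin n)
    {ι : Type*} (g : ι → MvPolynomial (Fin n) k) (x : Fin n → k) : multiplicity g x = ⊤ := by
  -- All partial derivatives of X_i^{p(m+1)} vanish. Taking m + 1 rather than m leaves out the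
  -- constant 1, whose operator is the identity.
  have hmem : ∀ m : ℕ, (monomial (Finsupp.single i (p * (m + 1))) (1 : k)) ∈ dualSpace g x := by
    intro m
    set q : MvPolynomial (Fin n) k := monomial (Finsupp.single i (p * (m + 1))) (1 : k) with hqdef
    have hq : ∀ j, pderiv j q = 0 := by
      intro j
      rw [hqdef, pderiv_monomial]
      by_cases h : j = i
      · subst h
        have : (p * (m + 1) : k) = 0 := by simp
        simp only [Finsupp.single_eq_same, Nat.cast_mul, Nat.cast_add, Nat.cast_one, this,
          mul_zero, monomial_zero]
      · simp [Finsupp.single_eq_of_ne h]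
    have hq0 : coeff 0 q = 0 := by
      rw [hqdef, coeff_monomial, if_neg]
      simpa only [Finsupp.single_eq_zero] using mul_ne_zero hp m.succ_ne_zero
    intro j α
    by_cases hα : α = 0
    · subst hα
      rw [partialD_zero, Module.End.one_apply, polyD_eq_zero_of_pderiv_eq_zero hq hq0]
      simp
    · rw [partialD_eq_zero_of_pderiv_eq_zero hq hα]
      simp
  have hli : LinearIndependent k fun m : ℕ => (⟨_, hmem m⟩ : dualSpace g x) := by
    refine LinearIndependent.of_comp (dualSpace g x).subtype ?_
    have := (basisMonomials (Fin n) k).linearIndependent.comp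
      (fun m : ℕ => Finsupp.single i (p * (m + 1))) fun a b h => by
        have := Finsupp.single_injective _ h
        simpa [hp] using this
    simpa [Function.comp_def, coe_basisMonomials] using this
  have := hli.aleph0_le_rank
  rw [multiplicity, Cardinal.toENat_eq_top]
  exact this

end Multiplicity

/-! ### Systems of parameters in a local Noetherian ring -/

section LocalAlgebra

open RingTheory.Sequence IsLocalRing

theorem isWeaklyRegular_concat_iff {R : Type*} [CommRing R] (l : List R) (x : R) :
    IsWeaklyRegular R (l ++ [x]) ↔
      IsWeaklyRegular R l ∧ ∀ a, x * a ∈ Ideal.ofList l → a ∈ Ideal.ofList l := by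
  rw [isWeaklyRegular_append_iff, isWeaklyRegular_singleton_iff, smul_eq_mul, Ideal.mul_top]
  refine and_congr_right fun _ => ?_
  rw [isSMulRegular_iff_right_eq_zero_of_smul]
  constructor
  · intro h a ha
    exact Ideal.Quotient.eq_zero_iff_mem.1 (h (Ideal.Quotient.mk _ a)
      (Ideal.Quotient.eq_zero_iff_mem.2 ha))
  · intro h a ha
    obtain ⟨a, rfl⟩ := Ideal.Quotient.mk_surjective a
    exact Ideal.Quotient.eq_zero_iff_mem.2 (h a (Ideal.Quotient.eq_zero_iff_mem.1 ha))

/-- The last element of a weakly regular sequence may be exchanged for any other element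
that generates, together with the preceding ones, an ideal with the old one in its radical. -/
theorem isWeaklyRegular_exchange {R : Type*} [CommRing R] {l : List R} {x z : R}
    (h : IsWeaklyRegular R (l ++ [x])) (hx : x ∈ (Ideal.ofList (z :: l)).radical) :
    IsWeaklyRegular R (l ++ [z]) := by
  rw [isWeaklyRegular_concat_iff] at h ⊢
  refine ⟨h.1, fun a ha => ?_⟩
  obtain ⟨N, hN⟩ := hx
  rw [Ideal.ofList_cons] at hN
  obtain ⟨_, hb, c, hc, hbc⟩ := Submodule.mem_sup.1 hN
  obtain ⟨b, rfl⟩ := Ideal.mem_span_singleton'.1 hb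
  have hpow : ∀ M : ℕ, x ^ M * a ∈ Ideal.ofList l → a ∈ Ideal.ofList l := by
    intro M
    induction M with
    | zero => simp
    | succ M ih => intro hM; rw [pow_succ', mul_assoc] at hM; exact ih (h.2 _ hM)
  -- Here x^N = b z + c with c in the ideal of l, so z a in that ideal puts x^N a there too.
  refine hpow N ?_
  rw [← hbc, add_mul, mul_assoc]
  exact add_mem (Ideal.mul_mem_left _ _ ha) (Ideal.mul_mem_right _ _ hc)

variable {R : Type*} [CommRing R] [IsLocalRing R] [IsNoetherianRing R]

/-- By Krull's principal ideal theorem modulo l, a nonmaximal prime containing l is minimal over l.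
So a z outside the nonmaximal minimal primes leaves only the maximal ideal above (z, l). -/
theorem maximalIdeal_le_radical_of_forall_minimalPrimes {l : List R} {x z : R}
    (hxl : ∀ r ∈ x :: l, r ∈ maximalIdeal R)
    (hx : maximalIdeal R ≤ (Ideal.ofList (x :: l)).radical)
    (hz : ∀ P ∈ (Ideal.ofList l).minimalPrimes, P ≠ maximalIdeal R → z ∉ P) :
    maximalIdeal R ≤ (Ideal.ofList (z :: l)).radical := by
  rw [Ideal.radical_eq_sInf (Ideal.ofList (z :: l))]
  refine le_sInf fun P ⟨hP, hPprime⟩ => ?_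
  rw [Ideal.ofList_cons, sup_le_iff] at hP
  by_contra hne
  have hPlt : P < maximalIdeal R := lt_of_le_not_ge (le_maximalIdeal hPprime.ne_top) hne
  have hzP : z ∈ P := hP.1 (Ideal.mem_span_singleton_self z)
  obtain ⟨Q, hQ, hQP⟩ := Ideal.exists_minimalPrimes_le hP.2
  have hPmin : P ∈ (Ideal.ofList l).minimalPrimes := by
    have hlist : Ideal.span (insert x {r | r ∈ l}) = Ideal.ofList (x :: l) := by
      rw [Ideal.ofList]; congr 1; ext; simp
    refine Ideal.mem_minimalPrimes_span_of_mem_minimalPrimes_span_insert hPlt x {r | r ∈ l}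
      ?_ {r | r ∈ l} (Ideal.span_le.1 hP.2) ?_
    · rw [hlist]
      refine ⟨⟨inferInstance, Ideal.span_le.2 hxl⟩, fun P' hP' _ => ?_⟩
      exact hx.trans (hP'.1.radical_le_iff.2 hP'.2)
    · exact fun r hr => Ideal.le_radical (Ideal.subset_span (Set.mem_insert_of_mem _ hr))
  exact hz P hPmin hPlt.ne hzP

/-- Prime avoidance, applied to the finitely many nonmaximal minimal primes of both lists at once.
-/
theorem exists_mem_maximalIdeal_le_radical {l₁ l₂ : List R} {x₁ x₂ : R}
    (hm₁ : ∀ r ∈ x₁ :: l₁, r ∈ maximalIdeal R) (hm₂ : ∀ r ∈ x₂ :: l₂, r ∈ maximalIdeal R)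
    (h₁ : maximalIdeal R ≤ (Ideal.ofList (x₁ :: l₁)).radical)
    (h₂ : maximalIdeal R ≤ (Ideal.ofList (x₂ :: l₂)).radical) :
    ∃ z ∈ maximalIdeal R, maximalIdeal R ≤ (Ideal.ofList (z :: l₁)).radical ∧
      maximalIdeal R ≤ (Ideal.ofList (z :: l₂)).radical := by
  classical
  let S : Set (Ideal R) := {P | (P ∈ (Ideal.ofList l₁).minimalPrimes ∨
    P ∈ (Ideal.ofList l₂).minimalPrimes) ∧ P ≠ maximalIdeal R}
  have hS : S.Finite := ((Ideal.finite_minimalPrimes_of_isNoetherianRing R _).union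
    (Ideal.finite_minimalPrimes_of_isNoetherianRing R _)).subset fun P hP => hP.1
  have hprime : ∀ P ∈ S, P.IsPrime := fun P hP => hP.1.elim (fun h => h.1.1) (fun h => h.1.1)
  obtain ⟨z, hz, hzS⟩ : ∃ z ∈ maximalIdeal R, ∀ P ∈ S, z ∉ P := by
    by_contra! hcon
    obtain ⟨P, hP, hle⟩ := (Ideal.subset_union_prime (s := hS.toFinset) (f := id)
      (I := maximalIdeal R) ⊥ ⊥ fun P hP _ _ => hprime P (hS.mem_toFinset.1 hP)).1 fun z hz => by
        obtain ⟨P, hP, hzP⟩ := hcon z hz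
        exact Set.mem_biUnion (by simpa using hP) hzP
    rw [hS.mem_toFinset] at hP
    exact hP.2 (((maximalIdeal.isMaximal R).eq_of_le (hprime P hP).ne_top hle).symm)
  exact ⟨z, hz, maximalIdeal_le_radical_of_forall_minimalPrimes hm₁ h₁
    fun P hP hne => hzS P ⟨Or.inl hP, hne⟩, maximalIdeal_le_radical_of_forall_minimalPrimes hm₂ h₂
    fun P hP hne => hzS P ⟨Or.inr hP, hne⟩⟩

/-- If a local Noetherian ring has a regular system of parameters, then every system of parameters
is regular. The list `c` is a common beginning of both systems. -/
theorem isWeaklyRegular_of_isWeaklyRegular : ∀ (a b c : List R), a.length = b.length →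
    (∀ r ∈ c ++ a, r ∈ maximalIdeal R) → (∀ r ∈ c ++ b, r ∈ maximalIdeal R) →
    IsWeaklyRegular R (c ++ a) → maximalIdeal R ≤ (Ideal.ofList (c ++ a)).radical →
    maximalIdeal R ≤ (Ideal.ofList (c ++ b)).radical → IsWeaklyRegular R (c ++ b)
  | [], [], _, _, _, _, ha, _, _ => ha
  | x :: a, y :: b, c, hlen, hma, hmb, ha, hra, hrb => by
    have perm (u : R) (l : List R) : Ideal.ofList (c ++ u :: l) = Ideal.ofList (u :: (c ++ l)) := by
      rw [Ideal.ofList, Ideal.ofList]; congr 1; ext; simp; tauto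
    rw [perm] at hra hrb
    -- The element z is a bridge: x is exchanged for z, then a for b with z joined to the common
    -- beginning, then z for y. Permutability of regular sequences in the maximal ideal brings each
    -- exchanged element to the end.
    obtain ⟨z, hz, hza, hzb⟩ := exists_mem_maximalIdeal_le_radical
      (fun r hr => hma r (List.perm_middle.mem_iff.2 hr))
      (fun r hr => hmb r (List.perm_middle.mem_iff.2 hr)) hra hrb
    have h1 : IsWeaklyRegular R ((c ++ a) ++ [x]) :=
      isWeaklyRegular_of_perm_of_subset_maximalIdeal ha
        (List.perm_middle.trans (List.perm_append_singleton _ _).symm) hma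
    have h2 := isWeaklyRegular_exchange h1 (hza (hma x (by simp)))
    have hma' : ∀ r ∈ (z :: c) ++ a, r ∈ maximalIdeal R := by
      intro r hr
      rcases List.mem_cons.1 hr with rfl | hr
      · exact hz
      · exact hma r (List.perm_middle.mem_iff.2 (List.mem_cons_of_mem _ hr))
    have hmb' : ∀ r ∈ (z :: c) ++ b, r ∈ maximalIdeal R := by
      intro r hr
      rcases List.mem_cons.1 hr with rfl | hr
      · exact hz
      · exact hmb r (List.perm_middle.mem_iff.2 (List.mem_cons_of_mem _ hr))
    have h3 : IsWeaklyRegular R ((z :: c) ++ a) :=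
      isWeaklyRegular_of_perm_of_subset_maximalIdeal h2 (List.perm_append_singleton _ _)
        fun r hr => hma' r (by simpa [or_comm, or_assoc, or_left_comm] using hr)
    have h4 := isWeaklyRegular_of_isWeaklyRegular a b (z :: c) (by simpa using hlen) hma' hmb' h3
      hza hzb
    have h5 : IsWeaklyRegular R ((c ++ b) ++ [z]) :=
      isWeaklyRegular_of_perm_of_subset_maximalIdeal h4 (List.perm_append_singleton _ _).symm hmb'
    have h6 := isWeaklyRegular_exchange h5 (hrb hz)
    exact isWeaklyRegular_of_perm_of_subset_maximalIdeal h6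
        ((List.perm_append_singleton _ _).trans List.perm_middle.symm)
        fun r hr => hmb r (by
          simp only [List.mem_append, List.mem_cons, List.not_mem_nil] at hr ⊢; tauto)

end LocalAlgebra

open RingTheory.Sequence Finset.HasAntidiagonal

/-! ### Homogeneous components and regular sequences of forms -/

section Graded

variable {k : Type*} [Field k] {n : ℕ}

theorem homogeneousComponent_monomial (d : ℕ) (s : Fin n →₀ ℕ) (c : k) :
    homogeneousComponent d (monomial s c) = if s.degree = d then monomial s c else 0 := by
  split_ifs with h
  · exact homogeneousComponent_eq_self (isHomogeneous_monomial c h)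
  · rw [homogeneousComponent_of_mem (n := s.degree) (isHomogeneous_monomial c rfl), if_neg]
    exact fun h' => h h'.symm

theorem homogeneousComponent_mul (d : ℕ) (p q : MvPolynomial (Fin n) k) :
    homogeneousComponent d (p * q) = ∑ ij ∈ antidiagonal d,
      homogeneousComponent ij.1 p * homogeneousComponent ij.2 q := by
  induction p using MvPolynomial.induction_on' with
  | add p p' hp hp' => simp only [add_mul, map_add, hp, hp', Finset.sum_add_distrib]
  | monomial s a =>
    induction q using MvPolynomial.induction_on' with
    | add q q' hq hq' => simp only [mul_add, map_add, hq, hq', Finset.sum_add_distrib]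
    | monomial t b =>
      rw [monomial_mul, homogeneousComponent_monomial, map_add]
      simp only [homogeneousComponent_monomial]
      by_cases h : s.degree + t.degree = d
      · rw [if_pos h, Finset.sum_eq_single (s.degree, t.degree)]
        · simp [monomial_mul]
        · rintro ⟨i, j⟩ _ hne
          by_cases hi : s.degree = i
          · rw [if_neg (c := t.degree = j), mul_zero]
            rintro rfl; exact hne (by rw [hi])
          · rw [if_neg hi, zero_mul]
        · simp [h]
      · rw [if_neg h, Finset.sum_eq_zero]
        rintro ⟨i, j⟩ hij
        rw [mem_antidiagonal] at hij
        by_cases hi : s.degree = i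
        · rw [if_neg (c := t.degree = j), mul_zero]
          rintro rfl; exact h (by rw [hi, hij])
        · rw [if_neg hi, zero_mul]

theorem homogeneousComponent_mul_of_isHomogeneous {p : MvPolynomial (Fin n) k} {i : ℕ}
    (hp : p.IsHomogeneous i) (q : MvPolynomial (Fin n) k) (j : ℕ) :
    homogeneousComponent (i + j) (p * q) = p * homogeneousComponent j q := by
  rw [homogeneousComponent_mul, Finset.sum_eq_single (i, j)]
  · rw [homogeneousComponent_eq_self hp]
  · rintro ⟨a, b⟩ hab hne
    rw [homogeneousComponent_of_mem (n := i) hp, if_neg, zero_mul]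
    rintro rfl
    rw [mem_antidiagonal] at hab
    exact hne (Prod.ext rfl (Nat.add_left_cancel hab))
  · simp

theorem homogeneousComponent_mul_of_totalDegree_le {p q : MvPolynomial (Fin n) k} {i j : ℕ}
    (hp : p.totalDegree ≤ i) (hq : q.totalDegree ≤ j) :
    homogeneousComponent (i + j) (p * q) =
      homogeneousComponent i p * homogeneousComponent j q := by
  rw [homogeneousComponent_mul, Finset.sum_eq_single (i, j)]
  · rintro ⟨a, b⟩ hab hne
    rw [mem_antidiagonal] at hab
    by_cases ha : i < a
    · rw [homogeneousComponent_eq_zero _ _ (hp.trans_lt ha), zero_mul]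
    · rw [homogeneousComponent_eq_zero b, mul_zero]
      refine hq.trans_lt ?_
      have : a ≠ i := fun h => hne (by subst h; exact Prod.ext rfl (Nat.add_left_cancel hab))
      omega
  · simp

theorem mem_of_forall_homogeneousComponent_mem {J : Ideal (MvPolynomial (Fin n) k)}
    {p : MvPolynomial (Fin n) k} (h : ∀ d, homogeneousComponent d p ∈ J) : p ∈ J := by
  rw [← sum_homogeneousComponent p]
  exact sum_mem fun d _ => h d

theorem homogeneousComponent_mem_span {s : Set (MvPolynomial (Fin n) k)}
    (hs : ∀ f ∈ s, ∃ d, f.IsHomogeneous d) {p : MvPolynomial (Fin n) k} (hp : p ∈ Ideal.span s)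
    (d : ℕ) : homogeneousComponent d p ∈ Ideal.span s := by
  induction hp using Submodule.span_induction generalizing d with
  | mem f hf =>
    obtain ⟨e, he⟩ := hs f hf
    rw [homogeneousComponent_of_mem he]
    split_ifs
    · exact Ideal.subset_span hf
    · exact zero_mem _
  | zero => simp
  | add p q _ _ hp hq => rw [map_add]; exact add_mem (hp d) (hq d)
  | smul a p _ hp =>
    rw [smul_eq_mul, homogeneousComponent_mul]
    exact sum_mem fun ij _ => Ideal.mul_mem_left _ _ (hp _)

/-- A homogeneous ideal is saturated with respect to polynomials not vanishing at the origin. -/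
theorem mem_span_of_mul_mem {s : Set (MvPolynomial (Fin n) k)}
    (hs : ∀ f ∈ s, ∃ d, f.IsHomogeneous d) {u a : MvPolynomial (Fin n) k}
    (hu : constantCoeff u ≠ 0) (h : u * a ∈ Ideal.span s) : a ∈ Ideal.span s := by
  refine mem_of_forall_homogeneousComponent_mem fun d => ?_
  -- The degree d part of u a is u_0 a_d plus terms containing a_j with j < d.
  induction d using Nat.strong_induction_on with
  | _ d ih =>
    have h1 := homogeneousComponent_mem_span hs h d
    rw [homogeneousComponent_mul, ← Finset.add_sum_erase _ _
      (show (0, d) ∈ antidiagonal d by simp)] at h1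
    have h2 : ∑ ij ∈ (antidiagonal d).erase (0, d),
        homogeneousComponent ij.1 u * homogeneousComponent ij.2 a ∈ Ideal.span s := by
      refine sum_mem fun ij hij => Ideal.mul_mem_left _ _ (ih _ ?_)
      obtain ⟨i, j⟩ := ij
      simp only [Finset.mem_erase, mem_antidiagonal, ne_eq, Prod.mk.injEq] at hij
      change j < d
      omega
    have h3 := (Submodule.add_mem_iff_left _ h2).1 h1
    rw [homogeneousComponent_zero] at h3
    have h4 := Ideal.mul_mem_left _ (C (constantCoeff u)⁻¹) h3
    rwa [← mul_assoc, ← C_mul, ← constantCoeff_eq, inv_mul_cancel₀ hu, C_1, one_mul] at h4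

/-- Membership in an ideal generated by variables is tested on exponents, and multiplying by another
variable X_j leaves the relevant exponents unchanged. -/
theorem isWeaklyRegular_map_X {l : List (Fin n)} (hl : l.Nodup) :
    IsWeaklyRegular (MvPolynomial (Fin n) k) (l.map (X (R := k))) := by
  induction l using List.reverseRecOn with
  | nil => exact IsWeaklyRegular.nil _ _
  | append_singleton l j ih =>
    rw [List.map_append, List.map_singleton, isWeaklyRegular_concat_iff]
    have hl' := List.nodup_append.1 hl
    refine ⟨ih hl'.1, fun a ha => ?_⟩
    have hspan : Ideal.ofList (l.map (X : Fin n → MvPolynomial (Fin n) k)) =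
        Ideal.span (X '' {i | i ∈ l}) := by
      rw [Ideal.ofList]; congr 1; ext; simp
    rw [hspan, mem_ideal_span_X_image] at ha ⊢
    intro m hm
    obtain ⟨i, hi, hne⟩ := ha (Finsupp.single j 1 + m) (by
      rw [mem_support_iff, coeff_X_mul]; exact mem_support_iff.1 hm)
    refine ⟨i, hi, ?_⟩
    have hij : i ≠ j := fun h => hl'.2.2 i hi j (by simp) h
    simpa [Finsupp.single_eq_of_ne hij] using hne

/-- A sequence of `n` forms in `n` variables without nontrivial common zeros is regular. -/
theorem isWeaklyRegular_of_forms [IsAlgClosed k] {fs : List (MvPolynomial (Fin n) k)}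
    (hlen : fs.length = n) (hhom : ∀ f ∈ fs, ∃ d, f.IsHomogeneous d)
    (hconst : ∀ f ∈ fs, constantCoeff f = 0)
    (hzero : ∀ v : Fin n → k, (∀ f ∈ fs, eval v f = 0) → v = 0) :
    IsWeaklyRegular (MvPolynomial (Fin n) k) fs := by
  let m : Ideal (MvPolynomial (Fin n) k) := RingHom.ker (constantCoeff (σ := Fin n) (R := k))
  have : m.IsPrime := RingHom.ker_isPrime _
  let S := Localization.AtPrime m
  have : IsNoetherianRing S := IsLocalization.isNoetherianRing m.primeCompl S inferInstance
  have hm : IsLocalRing.maximalIdeal S = m.map (algebraMap _ S) :=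
    (IsLocalization.AtPrime.map_eq_maximalIdeal m S).symm
  have hloc : ∀ l : List (MvPolynomial (Fin n) k), m ≤ (Ideal.ofList l).radical →
      IsLocalRing.maximalIdeal S ≤ (Ideal.ofList (l.map (algebraMap _ S))).radical := by
    intro l hl
    rw [hm, ← Ideal.map_ofList]
    exact (Ideal.map_mono hl).trans (Ideal.map_radical_le _)
  have hX : m ≤ Ideal.ofList ((List.finRange n).map X) := by
    intro p hp
    have hspan : Ideal.ofList ((List.finRange n).map (X : Fin n → MvPolynomial (Fin n) k)) =
        Ideal.span (X '' Set.univ) := by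
      rw [Ideal.ofList]; congr 1; ext; simp
    rw [hspan, mem_ideal_span_X_image]
    intro s hs
    by_contra! h
    have : s = 0 := Finsupp.ext fun i => h i trivial
    subst this
    exact mem_support_iff.1 hs hp
  have hf : m ≤ (Ideal.ofList fs).radical := by
    rw [← vanishingIdeal_zeroLocus_eq_radical (K := k)]
    intro p hp
    rw [mem_vanishingIdeal_iff]
    intro v hv
    have : v = 0 := hzero v fun f hf => by
      have := hv f (Ideal.subset_span hf)
      rwa [aeval_eq_eval] at this
    subst this
    rw [aeval_eq_eval]
    have h0 : constantCoeff p = 0 := hp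
    simpa [constantCoeff_eq, eval_zero] using h0
  have hmem : ∀ l : List (MvPolynomial (Fin n) k), (∀ f ∈ l, constantCoeff f = 0) →
      ∀ r ∈ l.map (algebraMap _ S), r ∈ IsLocalRing.maximalIdeal S := by
    intro l hl r hr
    obtain ⟨f, hf, rfl⟩ := List.mem_map.1 hr
    rw [hm]
    exact Ideal.mem_map_of_mem _ (hl f hf)
  have hreg : IsWeaklyRegular S (fs.map (algebraMap _ S)) := by
    refine isWeaklyRegular_of_isWeaklyRegular (((List.finRange n).map X).map (algebraMap _ S)) _ []
      (by simp [hlen]) (hmem _ ?_) (hmem _ hconst) ?_ (hloc _ (hX.trans Ideal.le_radical))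
      (hloc _ hf)
    · intro f hf
      obtain ⟨i, _, rfl⟩ := List.mem_map.1 hf
      simp
    · exact (isWeaklyRegular_map_X (List.nodup_finRange n)).of_isLocalization S m.primeCompl
  -- Descent to k[X] goes by initial segments, which do not inherit the conditions on length and
  -- zeros. Denominators do not vanish at the origin and are cancelled by `mem_span_of_mul_mem`.
  clear hlen hconst hzero hf
  induction fs using List.reverseRecOn with
  | nil => exact IsWeaklyRegular.nil _ _
  | append_singleton l f ih =>
    rw [List.map_append, List.map_singleton, isWeaklyRegular_concat_iff] at hreg
    have hhom' : ∀ f ∈ l, ∃ d, f.IsHomogeneous d := fun f hf => hhom f (by simp [hf])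
    rw [isWeaklyRegular_concat_iff]
    refine ⟨ih hhom' hreg.1, fun a ha => ?_⟩
    have h1 := hreg.2 (algebraMap _ S a) (by
      rw [← map_mul, ← Ideal.map_ofList]; exact Ideal.mem_map_of_mem _ ha)
    rw [← Ideal.map_ofList, IsLocalization.algebraMap_mem_map_algebraMap_iff m.primeCompl] at h1
    obtain ⟨u, hu, hua⟩ := h1
    exact mem_span_of_mul_mem hhom' (fun h => hu h) hua

end Graded

/-! ### Top forms, the affine Hilbert function and dim A -/

section Hilbert

variable {k : Type*} [Field k] {n : ℕ}

theorem eq_zero_or_totalDegree_lt {p : MvPolynomial (Fin n) k} {e : ℕ} (hp : p.totalDegree ≤ e)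
    (h : homogeneousComponent e p = 0) : p = 0 ∨ p.totalDegree < e := by
  by_contra! hcon
  have he : p.totalDegree = e := le_antisymm hp hcon.2
  obtain ⟨s, hs, hmax⟩ := Finset.exists_mem_eq_sup p.support (support_nonempty.2 hcon.1)
    fun s => s.sum fun _ e => e
  have h1 := congrArg (coeff s) h
  rw [coeff_homogeneousComponent, if_pos, coeff_zero] at h1
  · exact mem_support_iff.1 hs h1
  · rw [← he, totalDegree, hmax]; rfl

/-- Lifts forms back to the ideal of `gs`, with control of the degree; no regularity is needed. -/
theorem exists_mem_homogeneousComponent_eq {gs : List (MvPolynomial (Fin n) k)}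
    {c : MvPolynomial (Fin n) k} (hc : c ∈ Ideal.ofList (gs.map leadingForm)) (e : ℕ) :
    ∃ c' ∈ Ideal.ofList gs, c'.totalDegree ≤ e ∧
      homogeneousComponent e c' = homogeneousComponent e c := by
  induction hc using Submodule.span_induction generalizing e with
  | mem c hc =>
    obtain ⟨g, hg, rfl⟩ := List.mem_map.1 hc
    by_cases he : e = g.totalDegree
    · refine ⟨g, Ideal.subset_span hg, he.ge, ?_⟩
      rw [leadingForm, he, homogeneousComponent_eq_self (homogeneousComponent_isHomogeneous _ _)]
    · refine ⟨0, zero_mem _, by simp, ?_⟩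
      rw [leadingForm, homogeneousComponent_of_mem (homogeneousComponent_mem _ _),
        if_neg he, map_zero]
  | zero => exact ⟨0, zero_mem _, by simp, rfl⟩
  | add p q _ _ hp hq =>
    obtain ⟨p', hp', hpd, hpe⟩ := hp e
    obtain ⟨q', hq', hqd, hqe⟩ := hq e
    exact ⟨p' + q', add_mem hp' hq', (totalDegree_add _ _).trans (max_le hpd hqd),
      by rw [map_add, map_add, hpe, hqe]⟩
  | smul a p _ hp =>
    choose f hf hfd hfe using hp
    refine ⟨∑ ij ∈ antidiagonal e, homogeneousComponent ij.1 a * f ij.2,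
      sum_mem fun ij _ => Ideal.mul_mem_left _ _ (hf _), ?_, ?_⟩
    · refine totalDegree_finsetSum_le fun ij hij => (totalDegree_mul _ _).trans ?_
      rw [← mem_antidiagonal.1 hij]
      exact add_le_add (homogeneousComponent_isHomogeneous _ _).totalDegree_le (hfd _)
    · rw [map_sum, smul_eq_mul, homogeneousComponent_mul]
      refine Finset.sum_congr rfl fun ij hij => ?_
      rw [← mem_antidiagonal.1 hij, homogeneousComponent_mul_of_isHomogeneous
        (homogeneousComponent_isHomogeneous _ _), hfe]

/-- The leading forms of a list of polynomials generate the leading forms of its ideal. -/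
def IsStandard (gs : List (MvPolynomial (Fin n) k)) : Prop :=
  ∀ h ∈ Ideal.ofList gs, ∀ m, h.totalDegree ≤ m →
    homogeneousComponent m h ∈ Ideal.ofList (gs.map leadingForm)

/-- The reduction step of the inductions on degree. The case of difference 0 is separate because 0
has total degree 0, which is not below e = 0. -/
theorem exists_sub_totalDegree_lt {gs : List (MvPolynomial (Fin n) k)}
    {b : MvPolynomial (Fin n) k} {e : ℕ} (hb : b.totalDegree ≤ e)
    (h : homogeneousComponent e b ∈ Ideal.ofList (gs.map leadingForm)) :
    ∃ b' ∈ Ideal.ofList gs, b - b' = 0 ∨ (b - b').totalDegree < e := by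
  obtain ⟨b', hb', hd, he⟩ := exists_mem_homogeneousComponent_eq h e
  refine ⟨b', hb', eq_zero_or_totalDegree_lt ((totalDegree_sub _ _).trans (max_le hb hd)) ?_⟩
  rw [map_sub, he, homogeneousComponent_eq_self (homogeneousComponent_isHomogeneous _ _), sub_self]

variable {gs : List (MvPolynomial (Fin n) k)} {g : MvPolynomial (Fin n) k}

theorem IsStandard.mem_of_mul_mem (hgs : IsStandard gs)
    (hg : ∀ a, leadingForm g * a ∈ Ideal.ofList (gs.map leadingForm) →
      a ∈ Ideal.ofList (gs.map leadingForm))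
    {b : MvPolynomial (Fin n) k} (hb : g * b ∈ Ideal.ofList gs) : b ∈ Ideal.ofList gs := by
  induction he : b.totalDegree using Nat.strong_induction_on generalizing b with
  | _ e ih =>
    have h1 := hgs _ hb (g.totalDegree + e) ((totalDegree_mul _ _).trans (by rw [he]))
    rw [homogeneousComponent_mul_of_totalDegree_le le_rfl he.le] at h1
    obtain ⟨b', hb', hlt⟩ := exists_sub_totalDegree_lt he.le (hg _ h1)
    obtain h0 | hlt := hlt
    · rwa [sub_eq_zero.1 h0]
    · have := ih _ hlt (b := b - b') (by
        rw [mul_sub]; exact sub_mem hb (Ideal.mul_mem_left _ _ hb')) rfl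
      exact (Submodule.sub_mem_iff_left _ hb').1 this

/-- If g b has degree bound above m, its top form cancels against that of a. Regularity then puts
the top form of b in the ideal of leading forms, and a multiple of g moves from g b into a, lowering
deg b. -/
theorem IsStandard.exists_eq_add_mul (hgs : IsStandard gs)
    (hg : ∀ a, leadingForm g * a ∈ Ideal.ofList (gs.map leadingForm) →
      a ∈ Ideal.ofList (gs.map leadingForm))
    {h : MvPolynomial (Fin n) k} (hh : h ∈ Ideal.ofList (gs ++ [g])) {m : ℕ}
    (hm : h.totalDegree ≤ m) :
    ∃ a ∈ Ideal.ofList gs, ∃ b, h = a + g * b ∧ (b = 0 ∨ g.totalDegree + b.totalDegree ≤ m) := by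
  rw [Ideal.ofList_append, Ideal.ofList_singleton] at hh
  obtain ⟨a, ha, _, hb, rfl⟩ := Submodule.mem_sup.1 hh
  obtain ⟨b, rfl⟩ := Ideal.mem_span_singleton.1 hb
  clear hb hh
  induction he : b.totalDegree using Nat.strong_induction_on generalizing a b with
  | _ e ih =>
    by_cases hle : g.totalDegree + b.totalDegree ≤ m
    · exact ⟨a, ha, b, rfl, Or.inr hle⟩
    have hgb : (g * b).totalDegree ≤ g.totalDegree + e := (totalDegree_mul _ _).trans (by rw [he])
    have hda : a.totalDegree ≤ g.totalDegree + e := by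
      rw [← add_sub_cancel_right a (g * b)]
      exact (totalDegree_sub _ _).trans (max_le (hm.trans (by omega)) hgb)
    have h1 : homogeneousComponent (g.totalDegree + e) (a + g * b) = 0 :=
      homogeneousComponent_eq_zero _ _ (hm.trans_lt (by omega))
    rw [map_add, homogeneousComponent_mul_of_totalDegree_le le_rfl he.le] at h1
    have h2 := hgs a ha _ hda
    rw [eq_neg_of_add_eq_zero_left h1, neg_mem_iff] at h2
    obtain ⟨b', hb', hlt⟩ := exists_sub_totalDegree_lt he.le (hg _ h2)
    have heq : a + g * b = (a + g * b') + g * (b - b') := by ring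
    have hmem := add_mem ha (Ideal.mul_mem_left _ g hb')
    obtain h0 | hlt := hlt
    · exact ⟨_, hmem, _, heq, Or.inl h0⟩
    · obtain ⟨a'', ha'', b'', h'', hd''⟩ := ih _ hlt (a + g * b') hmem (b - b') (heq ▸ hm) rfl
      exact ⟨a'', ha'', b'', heq.trans h'', hd''⟩

/-- With a and g b both bounded by m, the degree m part is the sum of their degree m parts. -/
theorem IsStandard.concat (hgs : IsStandard gs)
    (hg : ∀ a, leadingForm g * a ∈ Ideal.ofList (gs.map leadingForm) →
      a ∈ Ideal.ofList (gs.map leadingForm)) : IsStandard (gs ++ [g]) := by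
  intro h hh m hm
  obtain ⟨a, ha, b, rfl, hb⟩ := hgs.exists_eq_add_mul hg hh hm
  rw [List.map_append, Ideal.ofList_append, List.map_singleton, Ideal.ofList_singleton]
  obtain rfl | hb := hb
  · rw [mul_zero, add_zero] at hm ⊢
    exact Ideal.mem_sup_left (hgs a ha m hm)
  · obtain ⟨e, rfl⟩ := Nat.exists_eq_add_of_le (Nat.le_of_add_right_le hb)
    have hbe : b.totalDegree ≤ e := by omega
    have hda : a.totalDegree ≤ g.totalDegree + e := by
      rw [← add_sub_cancel_right a (g * b)]
      exact (totalDegree_sub _ _).trans (max_le hm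
        ((totalDegree_mul _ _).trans (Nat.add_le_add_left hbe _)))
    rw [map_add, homogeneousComponent_mul_of_totalDegree_le le_rfl hbe]
    exact add_mem (Ideal.mem_sup_left (hgs a ha _ hda))
      (Ideal.mem_sup_right (Ideal.mul_mem_right _ _ (Ideal.mem_span_singleton_self _)))

/-- The elements of degree at most `m` of an ideal. -/
noncomputable def idealLE (J : Ideal (MvPolynomial (Fin n) k)) (m : ℕ) :
    Submodule k (MvPolynomial (Fin n) k) :=
  J.restrictScalars k ⊓ restrictTotalDegree (Fin n) k m

theorem mem_idealLE {J : Ideal (MvPolynomial (Fin n) k)} {m : ℕ} {p : MvPolynomial (Fin n) k} :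
    p ∈ idealLE J m ↔ p ∈ J ∧ p.totalDegree ≤ m := by
  rw [idealLE, Submodule.mem_inf, mem_restrictTotalDegree]; rfl

instance (J : Ideal (MvPolynomial (Fin n) k)) (m : ℕ) : FiniteDimensional k (idealLE J m) :=
  Submodule.finiteDimensional_inf_right _ _

/-- The affine Hilbert function of `k[X] ⧸ J`. -/
noncomputable def affineHilbert (J : Ideal (MvPolynomial (Fin n) k)) (m : ℕ) : ℤ :=
  Module.finrank k (restrictTotalDegree (Fin n) k m) - Module.finrank k (idealLE J m)

theorem IsStandard.idealLE_concat_of_lt (hgs : IsStandard gs)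
    (hg : ∀ a, leadingForm g * a ∈ Ideal.ofList (gs.map leadingForm) →
      a ∈ Ideal.ofList (gs.map leadingForm)) {m : ℕ} (hm : m < g.totalDegree) :
    idealLE (Ideal.ofList (gs ++ [g])) m = idealLE (Ideal.ofList gs) m := by
  ext p
  rw [mem_idealLE, mem_idealLE]
  refine and_congr_left fun hp => ⟨fun h => ?_, fun h => ?_⟩
  · obtain ⟨a, ha, b, rfl, hb⟩ := hgs.exists_eq_add_mul hg h hp
    obtain rfl : b = 0 := hb.resolve_right (by omega)
    simpa using ha
  · rw [Ideal.ofList_append]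
    exact Ideal.mem_sup_left h

/-- Writing S for k[X] and J for the old ideal, the new ideal in degree ≤ deg g + m is the sum of J
there and g S_{≤m}, by the bounded representation. The two meet in g J_{≤m}, since g is a
nonzerodivisor modulo J. -/
theorem IsStandard.finrank_idealLE_concat (hgs : IsStandard gs)
    (hg : ∀ a, leadingForm g * a ∈ Ideal.ofList (gs.map leadingForm) →
      a ∈ Ideal.ofList (gs.map leadingForm)) (hg0 : g ≠ 0) (m : ℕ) :
    Module.finrank k (idealLE (Ideal.ofList (gs ++ [g])) (g.totalDegree + m)) +
      Module.finrank k (idealLE (Ideal.ofList gs) m) =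
    Module.finrank k (idealLE (Ideal.ofList gs) (g.totalDegree + m)) +
      Module.finrank k (restrictTotalDegree (Fin n) k m) := by
  have hinj : Function.Injective (LinearMap.mulLeft k g) := mul_right_injective₀ hg0
  have hsup : idealLE (Ideal.ofList (gs ++ [g])) (g.totalDegree + m) =
      idealLE (Ideal.ofList gs) (g.totalDegree + m) ⊔
        (restrictTotalDegree (Fin n) k m).map (LinearMap.mulLeft k g) := by
    apply le_antisymm
    · intro p hp
      rw [mem_idealLE] at hp
      obtain ⟨a, ha, b, rfl, hb⟩ := hgs.exists_eq_add_mul hg hp.1 hp.2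
      have hbm : b.totalDegree ≤ m := by
        obtain rfl | hb := hb
        · simp
        · omega
      refine Submodule.add_mem_sup (mem_idealLE.2 ⟨ha, ?_⟩)
        ⟨b, (mem_restrictTotalDegree _ _ _).2 hbm, rfl⟩
      rw [← add_sub_cancel_right a (g * b)]
      exact (totalDegree_sub _ _).trans (max_le hp.2
        ((totalDegree_mul _ _).trans (Nat.add_le_add_left hbm _)))
    · refine sup_le (fun p hp => ?_) ?_
      · rw [mem_idealLE] at hp ⊢
        rw [Ideal.ofList_append]
        exact ⟨Ideal.mem_sup_left hp.1, hp.2⟩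
      · rintro _ ⟨b, hb, rfl⟩
        rw [SetLike.mem_coe, mem_restrictTotalDegree] at hb
        rw [mem_idealLE, Ideal.ofList_append, Ideal.ofList_singleton]
        exact ⟨Ideal.mem_sup_right (Ideal.mul_mem_right _ _ (Ideal.mem_span_singleton_self _)),
          (totalDegree_mul _ _).trans (Nat.add_le_add_left hb _)⟩
  have hinf : idealLE (Ideal.ofList gs) (g.totalDegree + m) ⊓
        (restrictTotalDegree (Fin n) k m).map (LinearMap.mulLeft k g) =
      (idealLE (Ideal.ofList gs) m).map (LinearMap.mulLeft k g) := by
    ext p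
    constructor
    · rintro ⟨hp, b, hb, rfl⟩
      rw [SetLike.mem_coe, mem_restrictTotalDegree] at hb
      exact ⟨b, mem_idealLE.2 ⟨hgs.mem_of_mul_mem hg (mem_idealLE.1 hp).1, hb⟩, rfl⟩
    · rintro ⟨b, hb, rfl⟩
      rw [SetLike.mem_coe, mem_idealLE] at hb
      exact ⟨mem_idealLE.2 ⟨Ideal.mul_mem_left _ _ hb.1,
        (totalDegree_mul _ _).trans (Nat.add_le_add_left hb.2 _)⟩,
        b, (mem_restrictTotalDegree _ _ _).2 hb.2, rfl⟩
  have h1 := Submodule.finrank_sup_add_finrank_inf_eq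
    (idealLE (Ideal.ofList gs) (g.totalDegree + m))
    ((restrictTotalDegree (Fin n) k m).map (LinearMap.mulLeft k g))
  rw [← hsup, hinf, ← (Submodule.equivMapOfInjective _ hinj _).finrank_eq,
    ← (Submodule.equivMapOfInjective _ hinj _).finrank_eq] at h1
  exact h1

theorem IsStandard.mk_affineHilbert_concat (hgs : IsStandard gs)
    (hg : ∀ a, leadingForm g * a ∈ Ideal.ofList (gs.map leadingForm) →
      a ∈ Ideal.ofList (gs.map leadingForm)) (hg0 : g ≠ 0) :
    PowerSeries.mk (affineHilbert (Ideal.ofList (gs ++ [g]))) =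
      PowerSeries.mk (affineHilbert (Ideal.ofList gs)) * (1 - PowerSeries.X ^ g.totalDegree) := by
  ext m
  rw [mul_sub, mul_one, map_sub, PowerSeries.coeff_mul_X_pow', PowerSeries.coeff_mk,
    PowerSeries.coeff_mk]
  split_ifs with h
  · obtain ⟨e, rfl⟩ := Nat.exists_eq_add_of_le h
    rw [Nat.add_sub_cancel_left, PowerSeries.coeff_mk]
    have := hgs.finrank_idealLE_concat hg hg0 e
    simp only [affineHilbert]
    omega
  · rw [affineHilbert, hgs.idealLE_concat_of_lt hg (not_le.1 h), sub_zero]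
    rfl

theorem finrank_restrictTotalDegree (m : ℕ) :
    Module.finrank k (restrictTotalDegree (Fin n) k m) = (n + m).choose n := by
  classical
  let s : Finset (Fin n →₀ ℕ) := (Finset.range (m + 1)).biUnion
    fun j => Finset.finsuppAntidiag Finset.univ j
  have hs : {d : Fin n →₀ ℕ | (d.sum fun _ e => e) ≤ m} = s := by
    ext d
    simp [s, Finset.mem_finsuppAntidiag, Finsupp.sum_fintype]
  have h1 : Module.finrank k (restrictTotalDegree (Fin n) k m) = s.card := by
    refine (Module.finrank_eq_nat_card_basis
      (basisRestrictSupport k {d : Fin n →₀ ℕ | (d.sum fun _ e => e) ≤ m})).trans ?_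
    rw [hs]
    simp
  rw [h1, Finset.card_biUnion]
  · simp only [Finset.card_finsuppAntidiag_nat_eq_multichoose, Finset.card_univ, Fintype.card_fin]
    have h2 : ∑ j ∈ Finset.range (m + 1), n.multichoose j = (n + 1).multichoose m := by
      clear * -
      induction m with
      | zero => simp
      | succ m ih => rw [Finset.sum_range_succ, ih, Nat.multichoose_succ_succ, add_comm]
    rw [h2, Nat.multichoose_eq, add_right_comm, Nat.add_sub_cancel, Nat.choose_symm_add]
  · intro i _ j _ hij
    refine Finset.disjoint_left.2 fun d hd hd' => hij ?_
    rw [Finset.mem_finsuppAntidiag] at hd hd'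
    exact hd.1.symm.trans hd'.1

/-- The exponent is n + 1 rather than n because the Hilbert function counts all degrees up to m. -/
theorem isStandard_and_mk_affineHilbert {gs : List (MvPolynomial (Fin n) k)}
    (hreg : IsWeaklyRegular (MvPolynomial (Fin n) k) (gs.map leadingForm))
    (h0 : ∀ g ∈ gs, g ≠ 0) :
    IsStandard gs ∧
      PowerSeries.mk (affineHilbert (Ideal.ofList gs)) * (1 - PowerSeries.X) ^ (n + 1) =
        (gs.map fun g => (1 - PowerSeries.X ^ g.totalDegree : PowerSeries ℤ)).prod := by
  induction gs using List.reverseRecOn with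
  | nil =>
    constructor
    · intro h hh m _
      simp only [List.map_nil, Ideal.ofList_nil, Ideal.mem_bot] at hh ⊢
      rw [hh, map_zero]
    · rw [List.map_nil, List.prod_nil]
      refine Eq.trans ?_ (PowerSeries.mk_add_choose_mul_one_sub_pow_eq_one ℤ n)
      congr 1
      ext m
      rw [PowerSeries.coeff_mk, PowerSeries.coeff_mk]
      have : idealLE (Ideal.ofList ([] : List (MvPolynomial (Fin n) k))) m = ⊥ := by
        rw [Ideal.ofList_nil, idealLE]; simp
      rw [affineHilbert, this, finrank_bot, finrank_restrictTotalDegree]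
      simp
  | append_singleton gs g ih =>
    rw [List.map_append, List.map_singleton, isWeaklyRegular_concat_iff] at hreg
    obtain ⟨hstd, hser⟩ := ih hreg.1 fun g hg => h0 g (by simp [hg])
    refine ⟨hstd.concat hreg.2, ?_⟩
    rw [hstd.mk_affineHilbert_concat hreg.2 (h0 g (by simp)), mul_right_comm, hser,
      List.map_append, List.prod_append]
    simp

theorem coeff_polynomial_mul_mk_one (Q : Polynomial ℤ) {m : ℕ} (hm : Q.natDegree ≤ m) :
    PowerSeries.coeff m ((Q : PowerSeries ℤ) * PowerSeries.mk 1) = Q.eval 1 := by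
  rw [PowerSeries.coeff_mul, Finset.Nat.sum_antidiagonal_eq_sum_range_succ_mk,
    Polynomial.eval_eq_sum_range' (Nat.lt_succ_of_le hm)]
  simp

/-- Each of the n factors 1 - t^d is (1 - t)(1 + … + t^{d-1}). Cancelling leaves Q/(1 - t), whose
coefficients are eventually Q(1) = ∏ d_i. -/
theorem exists_affineHilbert_eq {gs : List (MvPolynomial (Fin n) k)} (hlen : gs.length = n)
    (hreg : IsWeaklyRegular (MvPolynomial (Fin n) k) (gs.map leadingForm))
    (h0 : ∀ g ∈ gs, g ≠ 0) :
    ∃ M, ∀ m ≥ M, affineHilbert (Ideal.ofList gs) m = ((gs.map totalDegree).prod : ℕ) := by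
  have h := (isStandard_and_mk_affineHilbert hreg h0).2
  let Q : Polynomial ℤ :=
    (gs.map fun g => ∑ i ∈ Finset.range g.totalDegree, (Polynomial.X : Polynomial ℤ) ^ i).prod
  have hQ : ∀ gs : List (MvPolynomial (Fin n) k),
      (gs.map fun g => (1 - PowerSeries.X ^ g.totalDegree : PowerSeries ℤ)).prod =
      (1 - PowerSeries.X : PowerSeries ℤ) ^ gs.length * (((gs.map fun g =>
        ∑ i ∈ Finset.range g.totalDegree, (Polynomial.X : Polynomial ℤ) ^ i).prod :
          Polynomial ℤ) : PowerSeries ℤ) := by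
    intro gs
    clear * -
    induction gs with
    | nil => simp
    | cons g gs ih =>
      rw [List.map_cons, List.prod_cons, ih, List.map_cons, List.prod_cons, Polynomial.coe_mul,
        List.length_cons, ← mul_neg_geom_sum]
      have : ((∑ i ∈ Finset.range g.totalDegree, (Polynomial.X : Polynomial ℤ) ^ i :
          Polynomial ℤ) : PowerSeries ℤ) = ∑ i ∈ Finset.range g.totalDegree, PowerSeries.X ^ i := by
        rw [← Polynomial.coeToPowerSeries.ringHom_apply, map_sum]
        simp
      rw [this]; ring
  have hne : (1 - PowerSeries.X : PowerSeries ℤ) ≠ 0 := by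
    intro h
    have := congrArg PowerSeries.constantCoeff h
    simp at this
  have h1 : PowerSeries.mk (affineHilbert (Ideal.ofList gs)) * (1 - PowerSeries.X) =
      (Q : PowerSeries ℤ) := by
    refine mul_left_cancel₀ (pow_ne_zero n hne) ?_
    have h' := hQ gs
    rw [hlen] at h'
    rw [← h', ← h]; ring
  have h2 : PowerSeries.mk (affineHilbert (Ideal.ofList gs)) =
      (Q : PowerSeries ℤ) * PowerSeries.mk 1 := by
    rw [← h1, mul_assoc, mul_comm (1 - PowerSeries.X) (PowerSeries.mk 1),
      PowerSeries.mk_one_mul_one_sub_eq_one, mul_one]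
  refine ⟨Q.natDegree, fun m hm => ?_⟩
  rw [← PowerSeries.coeff_mk m (affineHilbert (Ideal.ofList gs)), h2,
    coeff_polynomial_mul_mk_one Q hm]
  rw [← Polynomial.coe_evalRingHom, map_list_prod, List.map_map, Nat.cast_list_prod, List.map_map]
  congr 2
  funext g
  simp [Polynomial.eval_finsetSum]

/-- The images of the polynomials of degree ≤ m increase and exhaust the quotient; their dimension
is the affine Hilbert function, so they are stationary from M on. -/
theorem finrank_quotient_of_affineHilbert_eq {J : Ideal (MvPolynomial (Fin n) k)} {M D : ℕ}
    (h : ∀ m ≥ M, affineHilbert J m = D) :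
    FiniteDimensional k (MvPolynomial (Fin n) k ⧸ J) ∧
      Module.finrank k (MvPolynomial (Fin n) k ⧸ J) = D := by
  let W : ℕ → Submodule k (MvPolynomial (Fin n) k ⧸ J) := fun m =>
    (restrictTotalDegree (Fin n) k m).map (Ideal.Quotient.mkₐ k J).toLinearMap
  have hW : ∀ m ≥ M, Module.finrank k (W m) = D := by
    intro m hm
    let φ := (Ideal.Quotient.mkₐ k J).toLinearMap.comp (restrictTotalDegree (Fin n) k m).subtype
    have hrange : LinearMap.range φ = W m := by
      rw [LinearMap.range_comp, Submodule.range_subtype]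
    have hker : (LinearMap.ker φ).map (restrictTotalDegree (Fin n) k m).subtype =
        idealLE J m := by
      ext p
      rw [mem_idealLE]
      constructor
      · rintro ⟨⟨p, hp⟩, hpk, rfl⟩
        exact ⟨Ideal.Quotient.eq_zero_iff_mem.1 hpk, (mem_restrictTotalDegree _ _ _).1 hp⟩
      · rintro ⟨hp, hd⟩
        exact ⟨⟨p, (mem_restrictTotalDegree _ _ _).2 hd⟩,
          Ideal.Quotient.eq_zero_iff_mem.2 hp, rfl⟩
    have h1 := φ.finrank_range_add_finrank_ker
    rw [hrange, (Submodule.equivMapOfInjective _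
      (restrictTotalDegree (Fin n) k m).injective_subtype _).finrank_eq, hker] at h1
    have h2 := h m hm
    rw [affineHilbert] at h2
    omega
  have hmono : Monotone W := fun a b hab => Submodule.map_mono fun p hp =>
    (mem_restrictTotalDegree _ _ _).2 (((mem_restrictTotalDegree _ _ _).1 hp).trans hab)
  have htop : W M = ⊤ := by
    refine Submodule.eq_top_iff'.2 fun a => ?_
    obtain ⟨p, rfl⟩ := Ideal.Quotient.mk_surjective a
    have hle : M ≤ max M p.totalDegree := le_max_left _ _
    rw [Submodule.eq_of_le_of_finrank_eq (hmono hle) ((hW M le_rfl).trans (hW _ hle).symm)]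
    exact ⟨p, (mem_restrictTotalDegree _ _ _).2 (le_max_right _ _), rfl⟩
  have hfin : FiniteDimensional k (⊤ : Submodule k (MvPolynomial (Fin n) k ⧸ J)) := by
    rw [← htop]; infer_instance
  exact ⟨Module.finite_def.2 (Module.Finite.iff_fg.1 hfin),
    by rw [← finrank_top, ← htop, hW M le_rfl]⟩

theorem finrank_quotient_eq_prod_totalDegree [IsAlgClosed k]
    (g : Fin n → MvPolynomial (Fin n) k) (hg : NoIntersectionAtInfinity g) :
    FiniteDimensional k (MvPolynomial (Fin n) k ⧸ Ideal.span (Set.range g)) ∧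
      Module.finrank k (MvPolynomial (Fin n) k ⧸ Ideal.span (Set.range g)) =
        ∏ i, (g i).totalDegree := by
  by_cases hconst : ∃ i, constantCoeff (leadingForm (g i)) ≠ 0
  -- A nonzero constant g_i generates the unit ideal, and both sides are 0.
  · obtain ⟨i, hi⟩ := hconst
    have hdeg : (g i).totalDegree = 0 := by
      by_contra h
      rw [leadingForm, constantCoeff_eq, coeff_homogeneousComponent, if_neg] at hi
      · exact hi rfl
      · simpa using Ne.symm h
    have hgi : g i = C (constantCoeff (leadingForm (g i))) := by
      conv_lhs => rw [totalDegree_eq_zero_iff_eq_C.1 hdeg]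
      rw [leadingForm, hdeg, homogeneousComponent_zero, constantCoeff_C]
    have htop : Ideal.span (Set.range g) = ⊤ := by
      refine Ideal.eq_top_of_isUnit_mem _ (Ideal.subset_span ⟨i, rfl⟩) ?_
      rw [hgi]
      exact (isUnit_iff_ne_zero.2 hi).map C
    have : Subsingleton (MvPolynomial (Fin n) k ⧸ Ideal.span (Set.range g)) :=
      Ideal.Quotient.subsingleton_iff.2 htop
    refine ⟨inferInstance, ?_⟩
    rw [Module.finrank_zero_of_subsingleton, Finset.prod_eq_zero (Finset.mem_univ i) hdeg]
  · push Not at hconst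
    have hreg : IsWeaklyRegular (MvPolynomial (Fin n) k) ((List.ofFn g).map leadingForm) := by
      refine isWeaklyRegular_of_forms (by simp) ?_ ?_ fun v hv => hg v fun i => hv _ ?_
      · intro f hf
        obtain ⟨h, -, rfl⟩ := List.mem_map.1 hf
        exact ⟨_, homogeneousComponent_isHomogeneous _ _⟩
      · intro f hf
        obtain ⟨h, hh, rfl⟩ := List.mem_map.1 hf
        obtain ⟨i, rfl⟩ := (List.mem_ofFn' g h).1 hh
        exact hconst i
      · exact List.mem_map_of_mem ((List.mem_ofFn' _ _).2 ⟨i, rfl⟩)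
    -- A zero entry in a weakly regular sequence would put 1 in the ideal of the preceding forms,
    -- which have no constant term.
    have hne : ∀ h ∈ List.ofFn g, h ≠ 0 := by
      rintro h hh rfl
      obtain ⟨l₁, l₂, hl⟩ := List.append_of_mem hh
      rw [hl, List.map_append, List.map_cons, List.append_cons, isWeaklyRegular_append_iff,
        isWeaklyRegular_concat_iff] at hreg
      have h1 := hreg.1.2 1 (by simp [leadingForm])
      have h2 : Ideal.ofList (l₁.map leadingForm) ≤
          RingHom.ker (constantCoeff (σ := Fin n) (R := k)) := by
        refine Ideal.span_le.2 fun f hf => ?_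
        obtain ⟨h, hh, rfl⟩ := List.mem_map.1 hf
        obtain ⟨i, rfl⟩ := (List.mem_ofFn' g h).1 (by rw [hl]; simp [hh])
        exact hconst i
      have h3 := h2 h1
      simp [RingHom.mem_ker] at h3
    obtain ⟨M, hM⟩ := exists_affineHilbert_eq (by simp) hreg hne
    have hspan : Ideal.ofList (List.ofFn g) = Ideal.span (Set.range g) := by
      rw [Ideal.ofList]; congr 1; ext h; exact List.mem_ofFn' g h
    rw [hspan] at hM
    have := finrank_quotient_of_affineHilbert_eq hM
    rwa [List.map_ofFn, List.prod_ofFn] at this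

end Hilbert

end Bezout

theorem mainTheorem1 {k : Type*} [Field k] [IsAlgClosed k] (n : ℕ)
    (g : Fin n → MvPolynomial (Fin n) k) (hg : Bezout.NoIntersectionAtInfinity g) :
    (∑' x : Fin n → k, Bezout.multiplicity g x) = ((∏ i, (g i).totalDegree : ℕ) : ℕ∞) ∨
      (∑' x : Fin n → k, Bezout.multiplicity g x) = ⊤ := by
  obtain ⟨hfin, hrank⟩ := Bezout.finrank_quotient_eq_prod_totalDegree g hg
  -- This holds in characteristic 0, and also for n = 0 in any characteristic, the product being
  -- empty.
  by_cases hfac : ∀ α : Fin n →₀ ℕ, ((∏ i, (α i).factorial : ℕ) : k) ≠ 0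
  · left
    rw [Bezout.tsum_multiplicity hfac g, hrank]
  · right
    push Not at hfac
    obtain ⟨α, hα⟩ := hfac
    obtain ⟨p, hp⟩ := CharP.exists k
    have hp0 : p ≠ 0 := by
      rintro rfl
      have := CharP.charP_to_charZero k
      rw [Nat.cast_eq_zero, Finset.prod_eq_zero_iff] at hα
      obtain ⟨i, -, hi⟩ := hα
      exact (α i).factorial_ne_zero hi
    obtain ⟨i⟩ : Nonempty (Fin n) := by
      by_contra h
      rw [not_nonempty_iff] at h
      simp at hα
    have h0 := Bezout.multiplicity_eq_top p hp0 i g 0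
    have hle := (Bezout.summable_multiplicity g).le_tsum (0 : Fin n → k) fun _ _ => zero_le
    rw [h0] at hle
    exact top_le_iff.1 hle
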